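/- A pseudotopological space is a set $X$ together with a relation "the filter $\mathcal F$ converges to the point $x$" between filters on $X$ and points of $X$ such that (i) the principal ultrafilter at $x$ converges to $x$ for every $x\in X$; (ii) if $\mathcal F$ converges to $x$ and $\mathcal G\supseteq\mathcal F$, then $\mathcal G$ converges to $x$; (iii) if $\mathcal F$ and $\mathcal G$ converge to $x$, then so does $\mathcal F\cap\mathcal G$; (iv) if every ultrafilter $\mathcal U\supseteq\mathcal F$ converges to $x$, then $\mathcal F$ converges to $x$. A map $f\colon X\to Y$ of pseudotopological spaces is continuous if, whenever $\mathcal F$ converges to $x$ in $X$, the image filter $f(\mathcal F)$ converges to $f(x)$ in $Y$. Let $\mathbf{PsTop}$ be the category of pseudotopological spaces and continuous maps. A topological space is regarded as a pseudotopological space in which $\mathcal F$ converges to $x$ if and only if $\mathcal F$ contains all neighbourhoods of $x$. For $n\ge 0$ let $D^n$ be the closed unit ball of $\mathbb R^n$ and $S^{n-1}\subset D^n$ the unit sphere, with their usual topologies (so $D^0$ is a point and $S^{-1}=\varnothing$). A pseudotopological space $X$ is a (pseudotopological) CW complex if it is the colimit in $\mathbf{PsTop}$ of a sequence $\varnothing=X_{-1}\to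 X_0\to X_1\to\cdots$ such that, for every $n\ge 0$, the map $X_{n-1}\to X_n$ is the inclusion of a subspace and there are a set $I_n$ and a pushout square in $\mathbf{PsTop}$ $$\begin{array}{ccc}\bigsqcup_{i\in I_n}S^{n-1}&\longrightarrow& X_{n-1}\\ \downarrow&&\downarrow\\ \bigsqcup_{i\in I_n}D^{n}&\longrightarrow& X_{n}\end{array}$$ whose left vertical map is the coproduct of the inclusions $S^{n-1}\hookrightarrow D^n$. Theorem. Let $X$ and $Y$ be pseudotopological CW complexes. Then the categorical product $X\times Y$ in $\mathbf{PsTop}$ is a pseudotopological CW complex. -/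

import Mathlib

open CategoryTheory Limits HomotopicalAlgebra

universe u

/-- A pseudotopology on a set `X`: a relation "the filter `F` converges to the point `x`" such that
principal ultrafilters converge, convergence passes to finer filters and to the intersection of two
filters (the supremum `F ⊔ G` in Mathlib's order), and a filter converges to `x` as soon as all
ultrafilters finer than it do.  (The improper filter `⊥` is allowed as an argument; the last axiom
forces it to converge to every point, so it carries no information.) -/
class PseudotopologicalSpace (X : Type u) where
  /-- `Converges F x`: the filter `F` converges to the point `x`. -/
  Converges : Filter X → X → Prop
  converges_pure (x : X) : Converges (pure x) x
  converges_mono {F G : Filter X} {x : X} (hGF : G ≤ F) (hF : Converges F x) : Converges G x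
  converges_sup {F G : Filter X} {x : X} (hF : Converges F x) (hG : Converges G x) : Converges (F ⊔ G) x
  converges_of_ultrafilter {F : Filter X} {x : X}
    (h : ∀ U : Ultrafilter X, (U : Filter X) ≤ F → Converges (U : Filter X) x) : Converges F x

namespace PseudotopologicalSpace

/-- The pseudotopology of a topological space: `F` converges to `x` iff `F` is finer than the
neighbourhood filter of `x`. -/
abbrev ofTopologicalSpace (X : Type u) [TopologicalSpace X] : PseudotopologicalSpace X where
  Converges F x := F ≤ nhds x
  converges_pure x := pure_le_nhds x
  converges_mono h hF := h.trans hF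
  converges_sup hF hG := sup_le hF hG
  converges_of_ultrafilter h := Filter.le_iff_ultrafilter.2 h

/-- An ultrafilter finer than an image filter lifts to an ultrafilter finer than the filter. -/
theorem exists_ultrafilter_of_le_map {X Y : Type u} (f : X → Y) {F : Filter X} {U : Ultrafilter Y}
    (hU : (U : Filter Y) ≤ F.map f) : ∃ V : Ultrafilter X, (V : Filter X) ≤ F ∧ V.map f = U := by
  have h : Filter.map f (F ⊓ Filter.comap f U) = U := by
    rw [Filter.push_pull]; exact inf_eq_right.2 hU
  have hne : (F ⊓ Filter.comap f (U : Filter Y)).NeBot :=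
    Filter.map_neBot_iff f |>.1 (by rw [h]; exact U.neBot)
  refine ⟨Ultrafilter.of (F ⊓ Filter.comap f U), (Ultrafilter.of_le (F ⊓ Filter.comap f U)).trans inf_le_left, ?_⟩
  refine Ultrafilter.coe_le_coe.1 ?_
  rw [Ultrafilter.coe_map]
  exact (Filter.map_mono (Ultrafilter.of_le _)).trans h.le

/-- The product pseudotopology: convergence of both projections. -/
instance instProd (X Y : Type u) [PseudotopologicalSpace X] [PseudotopologicalSpace Y] :
    PseudotopologicalSpace (X × Y) where
  Converges F p := Converges (F.map Prod.fst) p.1 ∧ Converges (F.map Prod.snd) p.2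
  converges_pure p := by simpa only [Filter.map_pure] using ⟨converges_pure p.1, converges_pure p.2⟩
  converges_mono h hF := ⟨converges_mono (Filter.map_mono h) hF.1, converges_mono (Filter.map_mono h) hF.2⟩
  converges_sup hF hG := by
    simpa only [Filter.map_sup] using ⟨converges_sup hF.1 hG.1, converges_sup hF.2 hG.2⟩
  converges_of_ultrafilter {F x} h := by
    refine ⟨converges_of_ultrafilter fun U hU => ?_, converges_of_ultrafilter fun U hU => ?_⟩
    · obtain ⟨V, hV, rfl⟩ := exists_ultrafilter_of_le_map _ hU
      exact (h V hV).1
    · obtain ⟨V, hV, rfl⟩ := exists_ultrafilter_of_le_map _ hU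
      exact (h V hV).2

/-- A map is continuous if it preserves convergence. -/
def IsContinuous {X Y : Type u} [PseudotopologicalSpace X] [PseudotopologicalSpace Y]
    (f : X → Y) : Prop :=
  ∀ ⦃F : Filter X⦄ ⦃x : X⦄, Converges F x → Converges (F.map f) (f x)

/-- An embedding: an injective map whose domain carries the subspace pseudotopology induced from
the codomain. -/
structure IsEmbedding {X Y : Type u} [PseudotopologicalSpace X] [PseudotopologicalSpace Y]
    (f : X → Y) : Prop where
  injective : Function.Injective f
  converges_iff (F : Filter X) (x : X) : Converges F x ↔ Converges (F.map f) (f x)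

end PseudotopologicalSpace

open PseudotopologicalSpace

/-- The type of pseudotopological spaces. -/
structure PsTop : Type (u + 1) where
  carrier : Type u
  [str : PseudotopologicalSpace carrier]

namespace PsTop

instance : CoeSort PsTop.{u} (Type u) := ⟨PsTop.carrier⟩

instance (X : PsTop.{u}) : PseudotopologicalSpace X := X.str

/-- Morphisms of pseudotopological spaces: continuous maps. -/
@[ext]
structure Hom (X Y : PsTop.{u}) : Type u where
  toFun : X → Y
  continuous : IsContinuous toFun

instance (X Y : PsTop.{u}) : FunLike (Hom X Y) X Y where
  coe f := f.toFun
  coe_injective _ _ h := Hom.ext h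

/-- The category of pseudotopological spaces and continuous maps. -/
instance : Category PsTop.{u} where
  Hom X Y := Hom X Y
  id X := ⟨id, fun F _ h => by simpa only [Filter.map_id, id] using h⟩
  comp f g := ⟨g.toFun ∘ f.toFun, fun F _ h => by
    rw [← Filter.map_map]; exact g.continuous (f.continuous h)⟩

instance : ConcreteCategory PsTop.{u} (fun X Y => Hom X Y) where
  hom f := f
  ofHom f := f

/-- The empty pseudotopological space. -/
def empty : PsTop.{u} where
  carrier := PEmpty.{u + 1}
  str :=
    { Converges := fun _ _ => True
      converges_pure := fun _ => trivial
      converges_mono := fun _ _ => trivial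
      converges_sup := fun _ _ => trivial
      converges_of_ultrafilter := fun _ => trivial }

/-- The empty space is initial. -/
def isInitialEmpty : IsInitial empty.{u} :=
  IsInitial.ofUniqueHom (fun _ => ⟨fun x => PEmpty.elim x, fun _ x _ => PEmpty.elim x⟩)
    (fun _ _ => Hom.ext (funext fun x => PEmpty.elim x))

instance : HasInitial PsTop.{u} := isInitialEmpty.hasInitial

/-- The product of two pseudotopological spaces with its two projections. -/
def prodFan (X Y : PsTop.{u}) : BinaryFan X Y :=
  BinaryFan.mk (P := ⟨X × Y⟩)
    (show Hom ⟨X × Y⟩ X from ⟨Prod.fst, fun _ _ h => h.1⟩)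
    (show Hom ⟨X × Y⟩ Y from ⟨Prod.snd, fun _ _ h => h.2⟩)

/-- `X × Y` is the categorical product. -/
def isLimitProdFan (X Y : PsTop.{u}) : IsLimit (prodFan X Y) :=
  BinaryFan.IsLimit.mk _
    (fun {T} (f : Hom T X) (g : Hom T Y) =>
      (show Hom T ⟨X × Y⟩ from ⟨fun t => (f.toFun t, g.toFun t), fun F t h => by
        refine ⟨?_, ?_⟩
        · rw [Filter.map_map]; exact f.continuous h
        · rw [Filter.map_map]; exact g.continuous h⟩))
    (fun _ _ => rfl) (fun _ _ => rfl)
    (fun _ _ m h₁ h₂ => Hom.ext (funext fun t => Prod.ext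
      (congrFun (congrArg Hom.toFun h₁) t) (congrFun (congrArg Hom.toFun h₂) t)))

instance : HasBinaryProducts PsTop.{u} :=
  have (X Y : PsTop.{u}) : HasLimit (pair X Y) := ⟨⟨⟨_, isLimitProdFan X Y⟩⟩⟩
  hasBinaryProducts_of_hasLimit_pair _

/-- The inclusion of topological spaces into pseudotopological spaces. -/
def ofTop : TopCat.{u} ⥤ PsTop.{u} where
  obj X := { carrier := X, str := ofTopologicalSpace X }
  map f := ⟨f, fun _ x h => (Filter.map_mono h).trans (f.hom.continuous.tendsto x)⟩

/-- The inclusion `S^{n-1} ⟶ D^n` of the unit sphere of `ℝⁿ` into the closed unit ball, in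
pseudotopological spaces; for `n = 0` it is the inclusion of the empty space into a point. -/
noncomputable abbrev basicCell (n : ℕ) (_ : Unit) :
    ofTop.{u}.obj (TopCat.diskBoundary n) ⟶ ofTop.{u}.obj (TopCat.disk n) :=
  ofTop.map (TopCat.diskBoundaryInclusion n)

/-- A CW structure on `X`: a sequence `F 0 ⟶ F 1 ⟶ ⋯` in `PsTop` with `F 0` the empty space and
with colimit `X`, together with, for each `n`, a pushout square in `PsTop` exhibiting `F (n + 1)` as
`F n` with a coproduct of `n`-cells `D^n` attached along a map from the coproduct of their boundary
spheres, such that `F n` is a subspace of `F (n + 1)`.  Thus `F n` is the `(n - 1)`-skeleton. -/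
structure CWStructure (X : PsTop.{u}) extends
    RelativeCellComplex.{u} (J := ℕ) basicCell.{u} (initial.to X) where
  isEmbedding (n : ℕ) : IsEmbedding (Hom.toFun (F.map (homOfLE (Order.le_succ n))))

/-- `X` is a pseudotopological CW complex. -/
def IsCWComplex (X : PsTop.{u}) : Prop := Nonempty (CWStructure X)

end PsTop

/-! By the last axiom a pseudotopology is determined by its convergent ultrafilters, and in a
colimit in `PsTop` these are exactly the images of convergent ultrafilters on the pieces
(`exists_lifts_of_final`). A CW complex is therefore a set with characteristic maps such that an
ultrafilter converges iff it lifts to a convergent ultrafilter on some cell. `CellDecomposition`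
records this, together with the uniqueness of interior points and the fact that the boundary of a
cell comes from cells of smaller dimension.

Such data pass to products because lifts can be combined: if the two projections of an ultrafilter
on `X × Y` lift to cells, the ultrafilter itself lifts to the product of the cells (`Lifts.prod`).
No local compactness or countability enters. Since `D^p × D^q` is a disk of dimension `p + q` with
the expected boundary, the products of cells decompose `X × Y`.

Conversely, a cell decomposition yields a CW structure whose stages are the unions of
low-dimensional cells with the subspace structure. The key point is `liftsBelow_of_mem_sk`: an
ultrafilter converging in `X` and containing such a union lifts to one of its own cells, so the
subspace structure is also the one glued from cells. -/

namespace PseudotopologicalSpace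

/-! ### Pseudotopologies described by ultrafilters -/

/-- The pseudotopology determined by a relation between ultrafilters and points which relates every
principal ultrafilter to its point. -/
abbrev ofUltrafilter {X : Type u} (R : Ultrafilter X → X → Prop) (hR : ∀ x, R (pure x) x) :
    PseudotopologicalSpace X where
  Converges F x := ∀ U : Ultrafilter X, (U : Filter X) ≤ F → R U x
  converges_pure x U hU := by
    have : U = pure x := Ultrafilter.coe_le_coe.1 (by simpa using hU)
    exact this ▸ hR x
  converges_mono h hF U hU := hF U (hU.trans h)
  converges_sup hF hG U hU := (Ultrafilter.le_sup_iff.1 hU).elim (hF U) (hG U)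
  converges_of_ultrafilter h U hU := h U hU U le_rfl

theorem isContinuous_iff_ultrafilter {X Y : Type u} [PseudotopologicalSpace X]
    [PseudotopologicalSpace Y] {f : X → Y} :
    IsContinuous f ↔ ∀ (U : Ultrafilter X) (x : X), Converges (U : Filter X) x →
      Converges (U.map f : Filter Y) (f x) := by
  refine ⟨fun h U x hU => h hU, fun h F x hF => converges_of_ultrafilter fun U hU => ?_⟩
  obtain ⟨V, hV, rfl⟩ := exists_ultrafilter_of_le_map f hU
  exact h V x (converges_mono hV hF)

/-- The subspace pseudotopology induced by a map. -/
abbrev induced {X Y : Type u} (f : X → Y) [PseudotopologicalSpace Y] : PseudotopologicalSpace X where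
  Converges F x := Converges (F.map f) (f x)
  converges_pure x := by simpa only [Filter.map_pure] using converges_pure (f x)
  converges_mono h hF := converges_mono (Filter.map_mono h) hF
  converges_sup hF hG := by simpa only [Filter.map_sup] using converges_sup hF hG
  converges_of_ultrafilter {F x} h := converges_of_ultrafilter fun U hU => by
    obtain ⟨V, hV, rfl⟩ := exists_ultrafilter_of_le_map f hU
    exact h V hV

end PseudotopologicalSpace

/-! ### Lifting convergent ultrafilters through colimits -/

namespace PsTop

/-- The indiscrete pseudotopological space on a type. -/
abbrev indiscrete (X : Type u) : PsTop.{u} where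
  carrier := X
  str := ofUltrafilter (fun _ _ => True) fun _ => trivial

/-- Every map to an indiscrete space is a morphism. -/
def toIndiscrete {X : PsTop.{u}} {Y : Type u} (f : X → Y) : X ⟶ indiscrete Y :=
  ⟨f, fun _ _ _ _ _ => trivial⟩

theorem toFun_comp {X Y Z : PsTop.{u}} (f : X ⟶ Y) (g : Y ⟶ Z) (x : X) :
    Hom.toFun (f ≫ g) x = Hom.toFun g (Hom.toFun f x) := rfl

theorem toFun_id {X : PsTop.{u}} (x : X) : Hom.toFun (𝟙 X) x = x := rfl

theorem hom_ext_toFun {X Y : PsTop.{u}} {f g : X ⟶ Y} (h : ∀ x, Hom.toFun f x = Hom.toFun g x) :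
    f = g :=
  Hom.ext (funext h)

/-- `U` and `x` are the images under `f` of a convergent ultrafilter and of its limit. -/
def Lifts {A : PsTop.{u}} {P : Type u} (f : A → P) (U : Ultrafilter P) (x : P) : Prop :=
  ∃ (V : Ultrafilter A) (a : A), Converges (V : Filter A) a ∧ V.map f = U ∧ f a = x

theorem Lifts.comp {A : PsTop.{u}} {P Q : Type u} {f : A → P} {U : Ultrafilter P} {x : P}
    (h : Lifts f U x) (g : P → Q) : Lifts (g ∘ f) (U.map g) (g x) := by
  obtain ⟨V, a, hV, rfl, rfl⟩ := h
  exact ⟨V, a, hV, (Ultrafilter.map_map V f g).symm, rfl⟩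

section Lifting

variable {J : Type*} {A : J → PsTop.{u}} {P : PsTop.{u}} (f : ∀ j, A j ⟶ P)

/-- The characteristic function of the union of the images and the constant function `True` agree on
every `A j`. Both are morphisms, as the target is indiscrete, so they coincide. -/
theorem exists_toFun_eq_of_jointly_epi
    (hext : ∀ (Q : PsTop.{u}) (φ ψ : P ⟶ Q), (∀ j, f j ≫ φ = f j ≫ ψ) → φ = ψ) (x : P) :
    ∃ j a, Hom.toFun (f j) a = x := by
  have := hext (indiscrete (ULift.{u} Prop))
    (toIndiscrete fun x => ⟨∃ j a, Hom.toFun (f j) a = x⟩) (toIndiscrete fun _ => ⟨True⟩)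
    fun j => hom_ext_toFun fun a => congrArg ULift.up (eq_true ⟨j, a, rfl⟩)
  exact of_eq_true (congrArg ULift.down (congrFun (congrArg Hom.toFun this) x))

/-- Convergent ultrafilters lift along a jointly strongly epimorphic family of morphisms. -/
theorem exists_lifts_of_final
    (hext : ∀ (Q : PsTop.{u}) (φ ψ : P ⟶ Q), (∀ j, f j ≫ φ = f j ≫ ψ) → φ = ψ)
    (hdesc : ∀ (Q : PsTop.{u}) (φ : P → Q) (g : ∀ j, A j ⟶ Q),
      (∀ j a, Hom.toFun (g j) a = φ (Hom.toFun (f j) a)) → ∃ ψ : P ⟶ Q, ∀ j, f j ≫ ψ = g j)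
    (U : Ultrafilter P) (x : P) (hU : Converges (U : Filter P) x) :
    ∃ j, Lifts (Hom.toFun (f j)) U x := by
  have hsurj := exists_toFun_eq_of_jointly_epi f hext
  -- `Q` is `P` with only the lifted ultrafilters convergent. The universal property makes the
  -- identity `P → Q` continuous, which is the claim; surjectivity supplies the principal
  -- ultrafilters.
  let Q : PsTop.{u} :=
    { carrier := P
      str := ofUltrafilter (fun U x => ∃ j, Lifts (Hom.toFun (f j)) U x) fun x => by
        obtain ⟨j, a, rfl⟩ := hsurj x
        exact ⟨j, pure a, a, converges_pure a, Ultrafilter.map_pure _ _, rfl⟩ }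
  let g (j : J) : A j ⟶ Q := ⟨Hom.toFun (X := A j) (Y := P) (f j),
    isContinuous_iff_ultrafilter.2 fun V a hV W hW => by
      rw [Ultrafilter.coe_le_coe.1 hW]
      exact ⟨j, V, a, hV, rfl, rfl⟩⟩
  obtain ⟨ψ, hψ⟩ := hdesc Q id g fun _ _ => rfl
  have hid : Hom.toFun ψ = id := funext fun x => by
    obtain ⟨j, a, rfl⟩ := hsurj x
    exact congrFun (congrArg Hom.toFun (hψ j)) a
  have := ψ.continuous hU
  rw [hid, Filter.map_id] at this
  exact this U le_rfl

end Lifting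

section AttachCells

variable {α : Type*} {A B : α → PsTop.{u}} {g : ∀ a, A a ⟶ B a} {X₁ X₂ : PsTop.{u}} {f : X₁ ⟶ X₂}
  (c : AttachCells.{u} g f)

/-- The attaching map of a cell. -/
def attachingMap (i : c.ι) : A (c.π i) ⟶ X₁ := c.cofan₁.inj i ≫ c.g₁

theorem attachingMap_comp (i : c.ι) : attachingMap c i ≫ f = g (c.π i) ≫ c.cell i := by
  rw [attachingMap, AttachCells.cell, Category.assoc, c.isPushout.w, AttachCells.hm_assoc]

theorem exists_desc {Q : PsTop.{u}} (s : X₁ ⟶ Q) (t : ∀ i, B (c.π i) ⟶ Q)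
    (h : ∀ i, attachingMap c i ≫ s = g (c.π i) ≫ t i) :
    ∃ ψ : X₂ ⟶ Q, f ≫ ψ = s ∧ ∀ i, c.cell i ≫ ψ = t i := by
  refine ⟨c.isPushout.desc s (Cofan.IsColimit.desc c.isColimit₂ t) ?_,
    c.isPushout.inl_desc _ _ _, fun i => ?_⟩
  · refine Cofan.IsColimit.hom_ext c.isColimit₁ _ _ fun i => ?_
    rw [AttachCells.hm_assoc, Cofan.IsColimit.fac, ← h, attachingMap, Category.assoc]
  · rw [AttachCells.cell, Category.assoc, c.isPushout.inr_desc, Cofan.IsColimit.fac]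

theorem exists_lifts_of_attachCells (U : Ultrafilter X₂) (x : X₂)
    (hU : Converges (U : Filter X₂) x) :
    Lifts (Hom.toFun f) U x ∨ ∃ i, Lifts (Hom.toFun (c.cell i)) U x := by
  -- The old space and the cells form a single family, with `none` for the old space.
  let A' : Option c.ι → PsTop.{u} := fun | none => X₁ | some i => B (c.π i)
  let k : ∀ j, A' j ⟶ X₂ := fun | none => f | some i => c.cell i
  obtain ⟨_ | i, h⟩ := exists_lifts_of_final k
    (fun Q φ ψ h => c.hom_ext (h none) fun i => h (some i))
    (fun Q φ l h => by
      obtain ⟨ψ, h₁, h₂⟩ := exists_desc c (l none) (fun i => l (some i)) fun i =>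
        hom_ext_toFun fun a => (h none _).trans <|
          (congrArg φ (congrFun (congrArg Hom.toFun (attachingMap_comp c i)) a)).trans
            (h (some i) _).symm
      exact ⟨ψ, fun | none => h₁ | some i => h₂ i⟩) U x hU
  · exact Or.inl h
  · exact Or.inr ⟨i, h⟩

end AttachCells

theorem exists_lifts_of_isColimit {J : Type*} [Category J] {F : J ⥤ PsTop.{u}} {c : Cocone F}
    (hc : IsColimit c) (U : Ultrafilter c.pt) (x : c.pt) (hU : Converges (U : Filter c.pt) x) :
    ∃ j, Lifts (Hom.toFun (c.ι.app j)) U x := by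
  refine exists_lifts_of_final c.ι.app (fun Q φ ψ h => hc.hom_ext h) (fun Q φ g h => ?_) U x hU
  refine ⟨hc.desc ⟨Q, ⟨g, fun i j k => hom_ext_toFun fun a => ?_⟩⟩, fun j => hc.fac _ j⟩
  refine (h j _).trans (Eq.trans ?_ (h i a).symm)
  exact congrArg φ (congrFun (congrArg Hom.toFun (c.w k)) a)

end PsTop

/-! ### Disks, their boundaries and cell decompositions -/

namespace PsTop

/-- The closed unit ball of `ℝⁿ` as a pseudotopological space. -/
noncomputable abbrev disk (n : ℕ) : PsTop.{u} := ofTop.obj (TopCat.disk n)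

/-- The unit sphere, as a subset of the closed unit ball. -/
def diskBd (n : ℕ) : Set (disk.{u} n) := Set.range (Hom.toFun (basicCell.{u} n ()))

theorem isClosedEmbedding_diskBoundaryInclusion (n : ℕ) :
    Topology.IsClosedEmbedding (TopCat.diskBoundaryInclusion.{u} n) := by
  have : T2Space (TopCat.disk.{u} n) :=
    inferInstanceAs (T2Space (ULift (Metric.closedBall (0 : EuclideanSpace ℝ (Fin n)) 1)))
  exact (TopCat.diskBoundaryInclusion n).hom.continuous.isClosedEmbedding
    ((TopCat.mono_iff_injective _).1 inferInstance)

theorem basicCell_injective (n : ℕ) : Function.Injective (Hom.toFun (basicCell.{u} n ())) :=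
  (isClosedEmbedding_diskBoundaryInclusion n).injective

/-- The sphere is closed in the disk, so the limit lies on it; as it also has the subspace topology,
the ultrafilter pulled back to it still converges. -/
theorem lifts_basicCell {n : ℕ} {V : Ultrafilter (disk.{u} n)} {d : disk.{u} n}
    (hV : Converges (V : Filter (disk.{u} n)) d) (h : diskBd n ∈ V) :
    Lifts (Hom.toFun (basicCell.{u} n ())) V d := by
  have he := isClosedEmbedding_diskBoundaryInclusion.{u} n
  have hne : (V : Filter (disk.{u} n)) ≤ nhds (X := TopCat.disk.{u} n) d := hV
  obtain ⟨s, rfl⟩ : d ∈ diskBd n :=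
    he.isClosed_range.mem_of_frequently_of_tendsto (Filter.Eventually.frequently h) hne
  have h' : Set.range (Hom.toFun (basicCell.{u} n ())) ∈ V := h
  refine ⟨V.comap (basicCell_injective n) h', s, ?_, ?_, rfl⟩
  · change _ ≤ nhds (X := TopCat.diskBoundary.{u} n) s
    rw [Ultrafilter.coe_comap]
    exact (Filter.comap_mono hne).trans (he.isInducing.nhds_eq_comap s).ge
  · refine Ultrafilter.coe_le_coe.1 ?_
    rw [Ultrafilter.coe_map, Ultrafilter.coe_comap]
    exact Filter.map_comap_le

/-- `U` and `x` are the images of a convergent ultrafilter and of its limit under a cell of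
dimension less than `m`. -/
def LiftsBelow {X : Type u} {ι : ℕ → Type u} (Φ : ∀ n, ι n → disk.{u} n → X) (m : ℕ)
    (U : Ultrafilter X) (x : X) : Prop :=
  ∃ n < m, ∃ i, Lifts (Φ n i) U x

/-- A decomposition of `X` into open cells with characteristic maps that determine the
convergence in `X` and send convergent ultrafilters on the boundary of a cell to ultrafilters that
come from cells of smaller dimension. -/
structure CellDecomposition (X : PsTop.{u}) where
  /-- the indices of the `n`-cells -/
  ι : ℕ → Type u
  /-- the characteristic maps -/
  Φ (n : ℕ) : ι n → disk.{u} n → X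
  interior_unique {n n' : ℕ} {i : ι n} {i' : ι n'} {d : disk n} {d' : disk n'} :
    d ∉ diskBd n → d' ∉ diskBd n' → Φ n i d = Φ n' i' d' →
      (⟨n, i, d⟩ : Σ n, Σ _ : ι n, disk.{u} n) = ⟨n', i', d'⟩
  boundary {n : ℕ} (i : ι n) {V : Ultrafilter (disk.{u} n)} {d : disk n} :
    Converges (V : Filter (disk n)) d → diskBd n ∈ V → LiftsBelow Φ n (V.map (Φ n i)) (Φ n i d)
  converges_iff (U : Ultrafilter X) (x : X) :
    Converges (U : Filter X) x ↔ ∃ n i, Lifts (Φ n i) U x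

/-! ### From a CW structure to a cell decomposition -/

namespace CWStructure

variable {X : PsTop.{u}} (c : CWStructure X)

/-- The attachment of the `n`-cells. -/
abbrev attach (n : ℕ) :
    AttachCells.{u} (basicCell.{u} n) (c.F.map (homOfLE (Order.le_succ n))) :=
  c.attachCells n (not_isMax n)

/-- The indices of the `n`-cells. -/
abbrev cellIndex (n : ℕ) : Type u := (c.attach n).ι

/-- The characteristic map of a cell, as a morphism. -/
noncomputable def charHom (n : ℕ) (i : c.cellIndex n) : disk.{u} n ⟶ X :=
  (c.attach n).cell i ≫ c.incl.app (Order.succ n)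

/-- The characteristic map of a cell. -/
noncomputable def char (n : ℕ) (i : c.cellIndex n) : disk.{u} n → X := Hom.toFun (c.charHom n i)

theorem isEmpty_zero (x : c.F.obj 0) : False :=
  PEmpty.elim (Hom.toFun (c.isoBot.hom ≫ initial.to empty) x)

/-- Induction on the stage: a convergent ultrafilter lifts either to the previous stage or to one of
the newly attached cells. -/
theorem liftsBelow_of_converges (n : ℕ) (U : Ultrafilter (c.F.obj n)) (x : c.F.obj n)
    (hU : Converges (U : Filter (c.F.obj n)) x) :
    LiftsBelow c.char n (U.map (Hom.toFun (c.incl.app n))) (Hom.toFun (c.incl.app n) x) := by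
  induction n with
  | zero => exact (c.isEmpty_zero x).elim
  | succ n ih =>
    obtain ⟨V, a, hV, rfl, rfl⟩ | ⟨i, h⟩ := exists_lifts_of_attachCells (c.attach n) U x hU
    · obtain ⟨m, hm, i, h⟩ := ih V a hV
      have e : c.F.map (homOfLE (Order.le_succ n)) ≫ c.incl.app (Order.succ n) = c.incl.app n :=
        (c.incl.naturality _).trans (Category.comp_id _)
      rw [← e] at h
      exact ⟨m, hm.trans n.lt_succ_self, i, h⟩
    · exact ⟨n, n.lt_succ_self, i, h.comp _⟩

theorem attachingMap_comp_incl (n : ℕ) (i : c.cellIndex n) :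
    attachingMap (c.attach n) i ≫ c.incl.app n = basicCell n () ≫ c.charHom n i := by
  have e : c.F.map (homOfLE (Order.le_succ n)) ≫ c.incl.app (Order.succ n) = c.incl.app n :=
    (c.incl.naturality _).trans (Category.comp_id _)
  rw [← e, ← Category.assoc, attachingMap_comp, charHom, Category.assoc]

theorem exists_toCells_succ {T : Type u} (t : ∀ n, c.cellIndex n → disk.{u} n → T) (n : ℕ)
    (r : c.F.obj n ⟶ indiscrete T) :
    ∃ r' : c.F.obj (n + 1) ⟶ indiscrete T, c.F.map (homOfLE (Order.le_succ n)) ≫ r' = r ∧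
      ∀ i, ∀ d ∉ diskBd n, Hom.toFun r' (Hom.toFun ((c.attach n).cell i) d) = t n i d := by
  classical
  obtain ⟨r', h₁, h₂⟩ := exists_desc (c.attach n) r
    -- On the boundary the value is forced by the attaching map; in the interior it is free, since
    -- continuity into an indiscrete space is automatic.
    (fun i => toIndiscrete (X := disk n) fun d => if h : d ∈ diskBd n then
      Hom.toFun r (Hom.toFun (attachingMap (c.attach n) i) h.choose) else t n i d) fun i => by
        refine hom_ext_toFun fun s => ?_
        have hs : Hom.toFun (basicCell n ()) s ∈ diskBd n := ⟨s, rfl⟩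
        refine Eq.trans ?_ (dif_pos hs).symm
        rw [basicCell_injective n hs.choose_spec]
        rfl
  exact ⟨r', h₁, fun i d hd => (congrFun (congrArg Hom.toFun (h₂ i)) d).trans (dif_neg hd)⟩

/-- Used to tell points of `X` apart: with `T` the set of all points of all cells, it shows that
open cells are disjoint and embedded injectively. -/
theorem exists_toCells {T : Type u} (t : ∀ n, c.cellIndex n → disk.{u} n → T) :
    ∃ ρ : X → T, ∀ n i, ∀ d ∉ diskBd n, ρ (c.char n i d) = t n i d := by
  choose next h₁ h₂ using c.exists_toCells_succ t
  let r (n : ℕ) : c.F.obj n ⟶ indiscrete T :=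
    Nat.rec (toIndiscrete fun x => (c.isEmpty_zero x).elim) next n
  let τ : c.F ⟶ (Functor.const ℕ).obj (indiscrete T) := NatTrans.ofSequence r fun n =>
    (h₁ n (r n)).trans (Category.comp_id _).symm
  refine ⟨Hom.toFun (c.isColimit.desc ⟨_, τ⟩), fun n i d hd => ?_⟩
  have := congrFun (congrArg Hom.toFun (c.isColimit.fac ⟨_, τ⟩ (n + 1)))
    (Hom.toFun ((c.attach n).cell i) d)
  exact this.trans (h₂ n (r n) i d hd)

/-- The cell decomposition underlying a CW structure. -/
noncomputable def cellDecomposition : CellDecomposition X where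
  ι := c.cellIndex
  Φ := c.char
  interior_unique {n n' i i' d d'} hd hd' h := by
    obtain ⟨ρ, hρ⟩ := c.exists_toCells
      (T := Σ n, Σ _ : c.cellIndex n, disk.{u} n) fun n i d => ⟨n, i, d⟩
    rw [← hρ n i d hd, ← hρ n' i' d' hd', h]
  boundary {n} i V d hV h := by
    obtain ⟨W, s, hW, rfl, rfl⟩ := lifts_basicCell hV h
    have h := c.liftsBelow_of_converges n (W.map (Hom.toFun (attachingMap (c.attach n) i)))
      (Hom.toFun (attachingMap (c.attach n) i) s) ((attachingMap (c.attach n) i).continuous hW)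
    rw [Ultrafilter.map_map] at h ⊢
    have e := congrArg Hom.toFun (c.attachingMap_comp_incl n i)
    have e₁ : Hom.toFun (c.incl.app n) ∘ Hom.toFun (attachingMap (c.attach n) i) =
      c.char n i ∘ Hom.toFun (basicCell n ()) := e
    have e₂ : Hom.toFun (c.incl.app n) (Hom.toFun (attachingMap (c.attach n) i) s) =
      c.char n i (Hom.toFun (basicCell n ()) s) := congrFun e₁ s
    rwa [e₁, e₂] at h
  converges_iff U x := by
    constructor
    · intro h
      obtain ⟨n, V, a, hV, rfl, rfl⟩ := exists_lifts_of_isColimit c.isColimit U x h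
      obtain ⟨m, -, i, h⟩ := c.liftsBelow_of_converges n V a hV
      exact ⟨m, i, h⟩
    · rintro ⟨n, i, V, d, hV, rfl, rfl⟩
      exact (c.charHom n i).continuous hV

end CWStructure

end PsTop

/-! ### A product of disks is a disk -/

theorem exists_homeomorph_euclideanSpace_prod {n p q : ℕ} (h : p + q = n) :
    ∃ g : EuclideanSpace ℝ (Fin n) ≃ₜ EuclideanSpace ℝ (Fin p) × EuclideanSpace ℝ (Fin q),
      ∀ x, (‖g x‖ ≤ 1 ↔ ‖x‖ ≤ 1) ∧ (‖g x‖ = 1 ↔ ‖x‖ = 1) := by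
  let L : EuclideanSpace ℝ (Fin n) ≃L[ℝ] EuclideanSpace ℝ (Fin p) × EuclideanSpace ℝ (Fin q) :=
    ContinuousLinearEquiv.ofFinrankEq (by simp [h])
  let s : Set (EuclideanSpace ℝ (Fin n)) := L ⁻¹' Metric.closedBall 0 1
  have hs : IsClosed s := Metric.isClosed_closedBall.preimage L.continuous
  have hi : interior s = L ⁻¹' Metric.ball 0 1 := by
    rw [← interior_closedBall _ one_ne_zero]
    exact (L.toHomeomorph.preimage_interior _).symm
  have hf : frontier s = L ⁻¹' Metric.sphere 0 1 := by
    rw [← frontier_closedBall _ one_ne_zero]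
    exact (L.toHomeomorph.preimage_frontier _).symm
  -- The product carries the sup norm, so `s` is the linear preimage of a product of balls: a
  -- bounded convex set with nonempty interior. Hence a homeomorphism of the whole space takes it to
  -- the round ball and its frontier to the sphere.
  obtain ⟨k, -, h₂, h₃⟩ := exists_homeomorph_image_interior_closure_frontier_eq_unitBall (s := s)
    ((convex_closedBall 0 1).linear_preimage L.toLinearMap)
    ⟨0, by rw [hi]; simp⟩
    (by
      have := (L.symm.lipschitz.isBounded_image
        (Metric.isBounded_closedBall (x := (0 : EuclideanSpace ℝ (Fin p) × EuclideanSpace ℝ (Fin q)))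
          (r := 1)))
      rwa [L.symm.image_eq_preimage_symm] at this)
  rw [hs.closure_eq] at h₂
  rw [hf] at h₃
  refine ⟨k.symm.trans L.toHomeomorph, fun x => ?_⟩
  have e₂ : k.symm x ∈ s ↔ x ∈ Metric.closedBall 0 1 := by
    rw [← h₂, k.image_eq_preimage_symm]; rfl
  have e₃ : k.symm x ∈ L ⁻¹' Metric.sphere 0 1 ↔ x ∈ Metric.sphere 0 1 := by
    rw [← h₃, k.image_eq_preimage_symm]; rfl
  exact ⟨by simpa [s] using e₂, by simpa using e₃⟩

namespace PsTop

theorem mem_diskBd {n : ℕ} (d : TopCat.disk.{u} n) :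
    d ∈ diskBd.{u} n ↔ ‖d.down.1‖ = 1 :=
  ⟨fun ⟨s, hs⟩ => hs ▸ mem_sphere_zero_iff_norm.1 s.down.2,
    fun h => ⟨⟨⟨d.down.1, mem_sphere_zero_iff_norm.2 h⟩⟩, rfl⟩⟩

theorem exists_diskHomeomorph {n p q : ℕ} (h : p + q = n) :
    ∃ e : TopCat.disk.{u} n ≃ₜ TopCat.disk.{u} p × TopCat.disk.{u} q,
      ∀ d, d ∈ diskBd n ↔ (e d).1 ∈ diskBd p ∨ (e d).2 ∈ diskBd q := by
  obtain ⟨g, hg⟩ := exists_homeomorph_euclideanSpace_prod h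
  have hle (d : TopCat.disk.{u} n) : ‖(g d.down.1).1‖ ≤ 1 ∧ ‖(g d.down.1).2‖ ≤ 1 :=
    max_le_iff.1 ((hg _).1.2 (mem_closedBall_zero_iff.1 d.down.2))
  let e : TopCat.disk.{u} n ≃ₜ TopCat.disk.{u} p × TopCat.disk.{u} q :=
    { toFun d := (⟨⟨(g d.down.1).1, mem_closedBall_zero_iff.2 (hle d).1⟩⟩,
        ⟨⟨(g d.down.1).2, mem_closedBall_zero_iff.2 (hle d).2⟩⟩)
      invFun d := ⟨⟨g.symm (d.1.down.1, d.2.down.1), mem_closedBall_zero_iff.2 <| (hg _).1.1 <| by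
        rw [g.apply_symm_apply]
        exact max_le (mem_closedBall_zero_iff.1 d.1.down.2) (mem_closedBall_zero_iff.1 d.2.down.2)⟩⟩
      left_inv d := ULift.down_injective (Subtype.ext (g.symm_apply_apply d.down.1))
      right_inv d := Prod.ext
        (ULift.down_injective (Subtype.ext (congrArg Prod.fst (g.apply_symm_apply _))))
        (ULift.down_injective (Subtype.ext (congrArg Prod.snd (g.apply_symm_apply _))))
      continuous_toFun := by
        have hd : Continuous fun d : TopCat.disk.{u} n => g d.down.1 :=
          g.continuous.comp (continuous_subtype_val.comp continuous_uliftDown)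
        exact (continuous_uliftUp.comp (hd.fst.subtype_mk _)).prodMk
          (continuous_uliftUp.comp (hd.snd.subtype_mk _))
      continuous_invFun := by
        refine continuous_uliftUp.comp (Continuous.subtype_mk (g.symm.continuous.comp ?_) _)
        exact ((continuous_subtype_val.comp continuous_uliftDown).comp continuous_fst).prodMk
          ((continuous_subtype_val.comp continuous_uliftDown).comp continuous_snd) }
  refine ⟨e, fun d => (mem_diskBd d).trans <| ((hg _).2.symm.trans ?_).trans
    (or_congr (mem_diskBd (e d).1) (mem_diskBd (e d).2)).symm⟩
  change max ‖(g d.down.1).1‖ ‖(g d.down.1).2‖ = 1 ↔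
    ‖(g d.down.1).1‖ = 1 ∨ ‖(g d.down.1).2‖ = 1
  have key : ∀ a b : ℝ, a ≤ 1 → b ≤ 1 → (max a b = 1 ↔ a = 1 ∨ b = 1) := by
    intro a b ha hb
    rw [max_eq_iff]
    grind
  exact key _ _ (hle d).1 (hle d).2

/-- The product of two pseudotopological spaces. -/
abbrev prod (X Y : PsTop.{u}) : PsTop.{u} := ⟨X × Y⟩

theorem exists_diskIso {n p q : ℕ} (h : p + q = n) :
    ∃ e : disk.{u} n ≅ (disk.{u} p).prod (disk.{u} q), ∀ d : disk n, d ∈ diskBd n ↔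
      (Hom.toFun e.hom d).1 ∈ diskBd p ∨ (Hom.toFun e.hom d).2 ∈ diskBd q := by
  obtain ⟨e, he⟩ := exists_diskHomeomorph.{u} h
  -- The neighbourhood filter of a pair is the product filter, so for disks the pseudotopological
  -- product is the topological one.
  have hp (F : Filter (TopCat.disk.{u} p × TopCat.disk.{u} q))
      (d : TopCat.disk.{u} p × TopCat.disk.{u} q) :
      Converges (X := (disk.{u} p).prod (disk.{u} q)) F d ↔ F ≤ nhds d :=
    Filter.le_prod.symm.trans (by rw [nhds_prod_eq]; exact Iff.rfl)
  exact ⟨{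
    hom := ⟨e, fun F d hF => (hp _ _).2 ((Filter.map_mono hF).trans (e.continuous.tendsto d))⟩
    inv := ⟨e.symm, fun F d hF =>
      (Filter.map_mono ((hp _ _).1 hF)).trans (e.symm.continuous.tendsto d)⟩
    hom_inv_id := hom_ext_toFun e.symm_apply_apply
    inv_hom_id := hom_ext_toFun e.apply_symm_apply }, he⟩

/-- An isomorphism of `Dⁿ` with `Dᵖ × D^q`, where `p + q = n`, that preserves boundaries. -/
noncomputable def diskIso {n p q : ℕ} (h : p + q = n) :
    disk.{u} n ≅ (disk.{u} p).prod (disk.{u} q) :=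
  (exists_diskIso h).choose

theorem mem_diskBd_iff_diskIso {n p q : ℕ} (h : p + q = n) (d : disk.{u} n) :
    d ∈ diskBd n ↔ (Hom.toFun (diskIso h).hom d).1 ∈ diskBd p ∨
      (Hom.toFun (diskIso h).hom d).2 ∈ diskBd q :=
  (exists_diskIso h).choose_spec d

theorem lifts_comp_iso {A B : PsTop.{u}} (e : A ≅ B) {Z : Type u} {k : B → Z} {U : Ultrafilter Z}
    {z : Z} : Lifts (k ∘ Hom.toFun e.hom) U z ↔ Lifts k U z := by
  have he : Hom.toFun e.hom ∘ Hom.toFun e.inv = id := congrArg Hom.toFun e.inv_hom_id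
  constructor
  · rintro ⟨V, d, hV, rfl, rfl⟩
    exact ⟨V.map (Hom.toFun e.hom), _, e.hom.continuous hV, rfl, rfl⟩
  · rintro ⟨V, d, hV, rfl, rfl⟩
    refine ⟨V.map (Hom.toFun e.inv), _, e.inv.continuous hV, ?_, congrArg k (congrFun he d)⟩
    rw [Ultrafilter.map_map, Function.comp_assoc, he, Function.comp_id]

/-! ### Products of lifts and of cell decompositions -/

section Prod

variable {A B : PsTop.{u}} {X Y : Type u} {f : A → X} {g : B → Y} {U : Ultrafilter (X × Y)}
  {z : X × Y}

/-- The preimage of `U` and the preimages of the two lifts `V` and `W` generate a proper filter on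
`A × B`; any finer ultrafilter maps to `U` and projects to `V` and `W`. -/
theorem Lifts.prod (hf : Lifts f (U.map Prod.fst) z.1) (hg : Lifts g (U.map Prod.snd) z.2) :
    Lifts (A := A.prod B) (Prod.map f g) U z := by
  obtain ⟨V, a, hV, hVU, ha⟩ := hf
  obtain ⟨W, b, hW, hWU, hb⟩ := hg
  have hne : (Filter.comap (Prod.map f g) (U : Filter (X × Y)) ⊓
      (Filter.comap Prod.fst (V : Filter A) ⊓ Filter.comap Prod.snd (W : Filter B))).NeBot := by
    rw [Filter.inf_neBot_iff]
    rintro s ⟨T, hT, hTs⟩ s' ⟨t₁, ⟨S, hS, hS₁⟩, t₂, ⟨R, hR, hR₂⟩, rfl⟩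
    -- As `U` projects to the images of `V` and `W`, it contains `f '' S ×ˢ g '' R`, which therefore
    -- meets `T`; a common point lifts to `S ×ˢ R`.
    have h₁ : Prod.fst ⁻¹' (f '' S) ∈ U := by
      rw [← Ultrafilter.mem_map, ← hVU]
      exact Filter.image_mem_map hS
    have h₂ : Prod.snd ⁻¹' (g '' R) ∈ U := by
      rw [← Ultrafilter.mem_map, ← hWU]
      exact Filter.image_mem_map hR
    obtain ⟨⟨x, y⟩, hxy, ⟨a, haS, rfl⟩, b, hbR, rfl⟩ :=
      U.nonempty_of_mem (Filter.inter_mem hT (Filter.inter_mem h₁ h₂))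
    exact ⟨(a, b), hTs hxy, hS₁ haS, hR₂ hbR⟩
  obtain ⟨T, hle⟩ := Ultrafilter.exists_le (Filter.comap (Prod.map f g) (U : Filter (X × Y)) ⊓
      (Filter.comap Prod.fst (V : Filter A) ⊓ Filter.comap Prod.snd (W : Filter B)))
  refine ⟨T, (a, b), ⟨converges_mono ?_ hV, converges_mono ?_ hW⟩,
    Ultrafilter.coe_le_coe.1 ?_, Prod.ext ha hb⟩
  · exact Filter.map_le_iff_le_comap.2 (hle.trans (inf_le_right.trans inf_le_left))
  · exact Filter.map_le_iff_le_comap.2 (hle.trans (inf_le_right.trans inf_le_right))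
  · exact Filter.map_le_iff_le_comap.2 (hle.trans inf_le_left)

theorem Lifts.fst (h : Lifts (A := A.prod B) (Prod.map f g) U z) :
    Lifts f (U.map Prod.fst) z.1 := by
  obtain ⟨V, a, hV, rfl, rfl⟩ := h
  exact ⟨V.map Prod.fst, a.1, hV.1, rfl, rfl⟩

theorem Lifts.snd (h : Lifts (A := A.prod B) (Prod.map f g) U z) :
    Lifts g (U.map Prod.snd) z.2 := by
  obtain ⟨V, a, hV, rfl, rfl⟩ := h
  exact ⟨V.map Prod.snd, a.2, hV.2, rfl, rfl⟩

end Prod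

namespace CellDecomposition

/-- The product of two cell decompositions. -/
noncomputable def prod {X Y : PsTop.{u}} (c : CellDecomposition X) (c' : CellDecomposition Y) :
    CellDecomposition (X.prod Y) where
  ι n := Σ pq : { pq : ℕ × ℕ // pq.1 + pq.2 = n }, c.ι pq.1.1 × c'.ι pq.1.2
  Φ n i := Prod.map (c.Φ _ i.2.1) (c'.Φ _ i.2.2) ∘ Hom.toFun (diskIso i.1.2).hom
  interior_unique := by
    rintro n n' ⟨⟨⟨p, q⟩, rfl⟩, i, j⟩ ⟨⟨⟨p', q'⟩, rfl⟩, i', j'⟩ d d' hd hd' h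
    have hd₀ := mt (mem_diskBd_iff_diskIso rfl d).2 hd
    have hd₀' := mt (mem_diskBd_iff_diskIso rfl d').2 hd'
    rw [not_or] at hd₀ hd₀'
    have h₁ := c.interior_unique hd₀.1 hd₀'.1 (congrArg Prod.fst h)
    have h₂ := c'.interior_unique hd₀.2 hd₀'.2 (congrArg Prod.snd h)
    clear h hd₀ hd₀'
    simp only [Sigma.mk.injEq] at h₁ h₂
    obtain ⟨rfl, h₁⟩ := h₁
    obtain ⟨rfl, h₂⟩ := h₂
    obtain ⟨rfl, h₁'⟩ := Sigma.mk.inj_iff.1 (eq_of_heq h₁)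
    obtain ⟨rfl, h₂'⟩ := Sigma.mk.inj_iff.1 (eq_of_heq h₂)
    have h := congrArg (Hom.toFun (diskIso rfl).inv) (Prod.ext (eq_of_heq h₁') (eq_of_heq h₂'))
    simp only [← toFun_comp, Iso.hom_inv_id, toFun_id] at h
    rw [h]
  boundary := by
    rintro n ⟨⟨⟨p, q⟩, rfl⟩, i, j⟩ V d hV h
    have hV' := (diskIso.{u} (p := p) (q := q) rfl).hom.continuous hV
    have h' : Prod.fst ⁻¹' diskBd p ∪ Prod.snd ⁻¹' diskBd q ∈
        V.map (Hom.toFun (diskIso.{u} (p := p) (q := q) rfl).hom) :=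
      Ultrafilter.mem_map.2 <|
        Filter.mem_of_superset h fun d => (mem_diskBd_iff_diskIso (p := p) (q := q) rfl d).1
    generalize hW : V.map (Hom.toFun (diskIso.{u} (p := p) (q := q) rfl).hom) = W at h'
    generalize hw : Hom.toFun (diskIso.{u} (p := p) (q := q) rfl).hom d = w at hV'
    have hV' : Converges (X := (disk.{u} p).prod (disk.{u} q)) W w := hW ▸ hV'
    -- An ultrafilter on the boundary lies on one of its two pieces. There one coordinate moves to a
    -- cell of smaller dimension and the other keeps its cell, so the total dimension drops.
    obtain h' | h' := Ultrafilter.union_mem_iff.1 h'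
    · obtain ⟨m, hm, k, hk⟩ := c.boundary i (V := W.map Prod.fst) hV'.1 h'
      refine ⟨m + q, by simpa using hm, ⟨⟨(m, q), rfl⟩, k, j⟩,
        (lifts_comp_iso (diskIso rfl)).2 (Lifts.prod ?_ ?_)⟩
      · subst hW hw; exact hk
      · subst hW hw; exact ⟨Ultrafilter.map Prod.snd (V.map _), _, hV'.2, rfl, rfl⟩
    · obtain ⟨m, hm, k, hk⟩ := c'.boundary j (V := W.map Prod.snd) hV'.2 h'
      refine ⟨p + m, by simpa using hm, ⟨⟨(p, m), rfl⟩, i, k⟩,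
        (lifts_comp_iso (diskIso rfl)).2 (Lifts.prod ?_ ?_)⟩
      · subst hW hw; exact ⟨Ultrafilter.map Prod.fst (V.map _), _, hV'.1, rfl, rfl⟩
      · subst hW hw; exact hk
  converges_iff U z := by
    constructor
    · rintro ⟨h₁, h₂⟩
      obtain ⟨p, i, hi⟩ := (c.converges_iff (U.map Prod.fst) z.1).1 h₁
      obtain ⟨q, j, hj⟩ := (c'.converges_iff (U.map Prod.snd) z.2).1 h₂
      exact ⟨p + q, ⟨⟨(p, q), rfl⟩, i, j⟩, (lifts_comp_iso (diskIso rfl)).2 (hi.prod hj)⟩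
    · rintro ⟨n, i, h⟩
      have h' := (lifts_comp_iso (diskIso i.1.2)).1 h
      exact ⟨(c.converges_iff (U.map Prod.fst) z.1).2 ⟨_, _, h'.fst⟩,
        (c'.converges_iff (U.map Prod.snd) z.2).2 ⟨_, _, h'.snd⟩⟩

/-- Transport of a cell decomposition along an isomorphism. -/
def ofIso {X Y : PsTop.{u}} (c : CellDecomposition X) (e : X ≅ Y) : CellDecomposition Y where
  ι := c.ι
  Φ n i := Hom.toFun e.hom ∘ c.Φ n i
  interior_unique hd hd' h := c.interior_unique hd hd' <| by
    have := congrArg (Hom.toFun e.inv) h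
    simpa only [Function.comp_apply, ← toFun_comp, e.hom_inv_id, toFun_id] using this
  boundary i V d hV h := by
    obtain ⟨m, hm, k, hk⟩ := c.boundary i hV h
    exact ⟨m, hm, k, hk.comp _⟩
  converges_iff U y := by
    have he : Hom.toFun e.hom ∘ Hom.toFun e.inv = id := congrArg Hom.toFun e.inv_hom_id
    constructor
    · intro h
      obtain ⟨n, i, h'⟩ := (c.converges_iff (U.map (Hom.toFun e.inv)) _).1 (e.inv.continuous h)
      have h'' := h'.comp (Hom.toFun e.hom)
      rw [Ultrafilter.map_map, he, Ultrafilter.map_id] at h''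
      have hy : Hom.toFun e.hom (Hom.toFun e.inv y) = y := congrFun he y
      rw [hy] at h''
      exact ⟨n, i, h''⟩
    · rintro ⟨n, i, V, d, hV, rfl, rfl⟩
      exact e.hom.continuous ((c.converges_iff _ _).2 ⟨n, i, V, d, hV, rfl, rfl⟩)

end CellDecomposition

end PsTop

/-! ### Coproducts of pseudotopological spaces -/

namespace PsTop

/-- The disjoint union of a family of pseudotopological spaces. -/
def sigma {J : Type u} (A : J → PsTop.{u}) : PsTop.{u} where
  carrier := Σ j, A j
  str := ofUltrafilter (X := Σ j, A j) (fun U x => Lifts (A := A x.1) (fun a => ⟨x.1, a⟩) U x)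
    fun x => ⟨pure x.2, x.2, converges_pure _, Ultrafilter.map_pure _ _, rfl⟩

section Sigma

variable {J : Type u} (A : J → PsTop.{u})

/-- The inclusion of a summand. -/
def sigmaInj (j : J) : A j ⟶ sigma A :=
  ⟨fun a => (⟨j, a⟩ : Σ j, A j), isContinuous_iff_ultrafilter.2 fun V a hV W hW => by
    rw [Ultrafilter.coe_le_coe.1 hW]
    exact ⟨V, a, hV, rfl, rfl⟩⟩

variable {A} in
/-- The morphism from a disjoint union given by a family of morphisms. -/
def sigmaDesc {Q : PsTop.{u}} (g : ∀ j, A j ⟶ Q) : sigma A ⟶ Q :=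
  ⟨fun x : Σ j, A j => Hom.toFun (g x.1) x.2, isContinuous_iff_ultrafilter.2 fun U x hU => by
    obtain ⟨V, a, hV, hVU, h⟩ := hU U le_rfl
    obtain rfl : a = x.2 := eq_of_heq (Sigma.mk.inj_iff.1 h).2
    rw [← hVU]
    exact (g x.1).continuous hV⟩

/-- The disjoint union is the coproduct. -/
def isColimitSigma : IsColimit (Cofan.mk (sigma A) (sigmaInj A)) :=
  Cofan.IsColimit.mk _ (fun t => sigmaDesc t.inj) (fun _ _ => rfl)
    (fun _ _ h => hom_ext_toFun fun (x : Σ j, A j) =>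
      congrFun (congrArg Hom.toFun (h x.1)) x.2)

end Sigma

/-! ### From a cell decomposition to a CW structure -/

namespace CellDecomposition

variable {X : PsTop.{u}} (c : CellDecomposition X)

theorem continuous_Φ (n : ℕ) (i : c.ι n) : IsContinuous (c.Φ n i) :=
  isContinuous_iff_ultrafilter.2 fun V d hV =>
    (c.converges_iff _ _).2 ⟨n, i, V, d, hV, rfl, rfl⟩

/-- The union of the cells of dimension less than `n`. -/
def sk (n : ℕ) : Set X := { x | ∃ m < n, ∃ i d, c.Φ m i d = x }

theorem sk_mono {m n : ℕ} (h : m ≤ n) : c.sk m ⊆ c.sk n :=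
  fun _ ⟨k, hk, hx⟩ => ⟨k, hk.trans_le h, hx⟩

theorem exists_mem_sk (x : X) : ∃ n, x ∈ c.sk n := by
  obtain ⟨n, i, V, d, -, -, rfl⟩ := (c.converges_iff (pure x) x).1 (converges_pure x)
  exact ⟨n + 1, n, n.lt_succ_self, i, d, rfl⟩

theorem mem_sk_of_mem_diskBd {n : ℕ} (i : c.ι n) {d : disk.{u} n} (hd : d ∈ diskBd n) :
    c.Φ n i d ∈ c.sk n := by
  obtain ⟨m, hm, j, V, d', -, -, h⟩ := c.boundary i (V := pure d) (converges_pure d) hd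
  exact ⟨m, hm, j, d', h⟩

theorem exists_interior {n : ℕ} {x : X} (hx : x ∈ c.sk n) :
    ∃ m < n, ∃ i, ∃ d ∉ diskBd m, c.Φ m i d = x := by
  induction n using Nat.strong_induction_on with
  | _ n ih =>
    obtain ⟨m, hm, i, d, rfl⟩ := hx
    by_cases hd : d ∈ diskBd m
    · obtain ⟨k, hk, h⟩ := ih m hm (c.mem_sk_of_mem_diskBd i hd)
      exact ⟨k, hk.trans hm, h⟩
    · exact ⟨m, hm, i, d, hd, rfl⟩

/-- An interior point of an `n`-cell would also be interior to a cell of dimension less than `m ≤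
n`, contradicting uniqueness. -/
theorem mem_diskBd_of_mem_sk {m n : ℕ} (hmn : m ≤ n) {i : c.ι n} {d : disk.{u} n}
    (h : c.Φ n i d ∈ c.sk m) : d ∈ diskBd n := by
  by_contra hd
  obtain ⟨k, hk, j, d', hd', h⟩ := c.exists_interior h
  have := congrArg Sigma.fst (c.interior_unique hd' hd h)
  exact (hk.trans_le hmn).ne this

/-- If the lift lives on a cell of dimension at least `m`, it contains the boundary of that cell, so
it can be replaced by a lift to a smaller cell; this descent ends below `m`. -/
theorem liftsBelow_of_mem_sk {m : ℕ} {U : Ultrafilter X} {x : X}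
    (hU : Converges (U : Filter X) x) (hm : c.sk m ∈ U) : LiftsBelow c.Φ m U x := by
  obtain ⟨n, i, h⟩ := (c.converges_iff U x).1 hU
  induction n using Nat.strong_induction_on with
  | _ n ih =>
    obtain hn | hn := lt_or_ge n m
    · exact ⟨n, hn, i, h⟩
    · obtain ⟨V, d, hV, rfl, rfl⟩ := h
      have hbd : diskBd n ∈ V :=
        Filter.mem_of_superset (Ultrafilter.mem_map.1 hm) fun d hd => c.mem_diskBd_of_mem_sk hn hd
      obtain ⟨k, hk, j, h⟩ := c.boundary i hV hbd
      exact ih k hk j h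

/-- The union of the cells of dimension less than `n` as a subspace. -/
def skObj (n : ℕ) : PsTop.{u} where
  carrier := c.sk n
  str := induced Subtype.val

/-- The inclusion of the subspace `skObj n`. -/
def skIncl (n : ℕ) : c.skObj n ⟶ X := ⟨Subtype.val, fun _ _ h => h⟩

/-- The inclusions between the subspaces `skObj n`. -/
def skMap {m n : ℕ} (h : m ≤ n) : c.skObj m ⟶ c.skObj n :=
  ⟨Set.inclusion (c.sk_mono h), fun _ _ hF => hF⟩

/-- The sequence of the subspaces `skObj n`. -/
def skFunctor : ℕ ⥤ PsTop.{u} where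
  obj := c.skObj
  map h := c.skMap (leOfHom h)

/-- A morphism to `X` with values in `sk n` factors through `skObj n`. -/
def skLift {A : PsTop.{u}} {f : A → X} (hf : IsContinuous f) (n : ℕ) (h : ∀ a, f a ∈ c.sk n) :
    A ⟶ c.skObj n :=
  ⟨fun a => ⟨f a, h a⟩, fun _ _ hF => hf hF⟩

/-- The characteristic map of an `n`-cell as a morphism to `skObj m` for `n < m`. -/
noncomputable def cellHom {n m : ℕ} (h : n < m) (i : c.ι n) : disk.{u} n ⟶ c.skObj m :=
  c.skLift (c.continuous_Φ n i) m fun d => ⟨n, h, i, d, rfl⟩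

/-- The attaching map of an `n`-cell. -/
noncomputable def attachHom {n : ℕ} (i : c.ι n) : ofTop.{u}.obj (TopCat.diskBoundary n) ⟶ c.skObj n :=
  c.skLift (f := c.Φ n i ∘ Hom.toFun (basicCell n ()))
    (fun F s hF => by
      rw [← Filter.map_map]
      exact c.continuous_Φ n i ((basicCell n ()).continuous hF)) n
    fun s => c.mem_sk_of_mem_diskBd i ⟨s, rfl⟩

/-- Continuity on `skObj n` can be tested on the cells of dimension less than `n`. -/
theorem isContinuous_of_cellHom {n : ℕ} {Q : PsTop.{u}} {φ : c.skObj n → Q}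
    (h : ∀ m (hm : m < n) i, IsContinuous (φ ∘ Hom.toFun (c.cellHom hm i))) : IsContinuous φ := by
  refine isContinuous_iff_ultrafilter.2 fun U x hU => ?_
  have hn : c.sk n ∈ U.map (Subtype.val : c.skObj n → X) :=
    Ultrafilter.mem_map.2 (Filter.univ_mem' fun x => Subtype.property x)
  obtain ⟨m, hm, i, V, d, hV, hVU, hd⟩ := c.liftsBelow_of_mem_sk hU hn
  obtain rfl : Hom.toFun (c.cellHom hm i) d = x := Subtype.ext hd
  have hU : V.map (Hom.toFun (c.cellHom hm i)) = U := by
    refine Ultrafilter.coe_injective (Filter.map_injective Subtype.val_injective ?_)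
    exact congrArg Ultrafilter.toFilter hVU
  subst hU
  exact h m hm i hV

/-- The map is defined pointwise, by `s` on the old part and by the unique interior representative
elsewhere; the compatibility `h` settles the boundary. Continuity need only be tested on cells. -/
theorem exists_sk_desc {n : ℕ} {Q : PsTop.{u}} (s : c.skObj n ⟶ Q) (t : ∀ _ : c.ι n, disk.{u} n ⟶ Q)
    (h : ∀ i, c.attachHom i ≫ s = basicCell n () ≫ t i) :
    ∃ ψ : c.skObj (n + 1) ⟶ Q, c.skMap n.le_succ ≫ ψ = s ∧
      ∀ i, c.cellHom n.lt_succ_self i ≫ ψ = t i := by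
  classical
  have hex (x : c.skObj (n + 1)) (hx : x.1 ∉ c.sk n) : ∃ y : Σ _ : c.ι n, disk.{u} n,
      y.2 ∉ diskBd n ∧ c.Φ n y.1 y.2 = x.1 := by
    obtain ⟨m, hm, i, d, hd, h⟩ := c.exists_interior x.2
    obtain rfl : m = n := by
      by_contra hmn
      exact hx ⟨m, by omega, i, d, h⟩
    exact ⟨⟨i, d⟩, hd, h⟩
  let φ (x : c.skObj (n + 1)) : Q := if hx : x.1 ∈ c.sk n then Hom.toFun s ⟨x.1, hx⟩ else
    Hom.toFun (t (hex x hx).choose.1) (hex x hx).choose.2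
  have hφs (x : c.skObj n) : φ (Hom.toFun (c.skMap n.le_succ) x) = Hom.toFun s x := dif_pos x.2
  have hφt (i : c.ι n) (d : disk.{u} n) :
      φ (Hom.toFun (c.cellHom n.lt_succ_self i) d) = Hom.toFun (t i) d := by
    by_cases hx : c.Φ n i d ∈ c.sk n
    · obtain ⟨a, rfl⟩ := c.mem_diskBd_of_mem_sk le_rfl hx
      exact (dif_pos hx).trans (congrFun (congrArg Hom.toFun (h i)) a)
    · refine (dif_neg hx).trans ?_
      obtain ⟨h₁, h₂⟩ := (hex (Hom.toFun (c.cellHom n.lt_succ_self i) d) hx).choose_spec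
      have hd : d ∉ diskBd n := fun hd => hx (c.mem_sk_of_mem_diskBd i hd)
      have := c.interior_unique h₁ hd h₂
      have := eq_of_heq (Sigma.mk.inj_iff.1 this).2
      obtain ⟨h₃, h₄⟩ := Sigma.mk.inj_iff.1 this
      rw [h₃, eq_of_heq h₄]
  refine ⟨⟨φ, c.isContinuous_of_cellHom fun m hm i => ?_⟩, hom_ext_toFun hφs,
    fun i => hom_ext_toFun (hφt i)⟩
  obtain hmn | rfl := Nat.lt_succ_iff_lt_or_eq.1 hm
  · have e : φ ∘ Hom.toFun (c.cellHom hm i) = Hom.toFun (c.cellHom hmn i ≫ s) :=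
      funext fun d => hφs (Hom.toFun (c.cellHom hmn i) d)
    rw [e]
    exact (c.cellHom hmn i ≫ s).continuous
  · have e : φ ∘ Hom.toFun (c.cellHom hm i) = Hom.toFun (t i) := funext (hφt i)
    rw [e]
    exact (t i).continuous

theorem sk_hom_ext {n : ℕ} {Q : PsTop.{u}} {φ ψ : c.skObj (n + 1) ⟶ Q}
    (h : c.skMap n.le_succ ≫ φ = c.skMap n.le_succ ≫ ψ)
    (h' : ∀ i, c.cellHom n.lt_succ_self i ≫ φ = c.cellHom n.lt_succ_self i ≫ ψ) : φ = ψ := by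
  refine hom_ext_toFun fun ⟨x, m, hm, i, d, hx⟩ => ?_
  subst hx
  obtain hmn | rfl := Nat.lt_succ_iff_lt_or_eq.1 hm
  · exact congrFun (congrArg Hom.toFun h) ⟨_, m, hmn, i, d, rfl⟩
  · exact congrFun (congrArg Hom.toFun (h' i)) d

/-- `skObj (n + 1)` is obtained from `skObj n` by attaching `n`-cells. -/
noncomputable def attachCells (n : ℕ) :
    AttachCells.{u} (basicCell.{u} n) (c.skFunctor.map (homOfLE (Order.le_succ n))) where
  ι := c.ι n
  π _ := ()
  cofan₁ := Cofan.mk _ (sigmaInj _)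
  cofan₂ := Cofan.mk _ (sigmaInj _)
  isColimit₁ := isColimitSigma _
  isColimit₂ := isColimitSigma _
  m := sigmaDesc fun i => basicCell n () ≫ sigmaInj (fun _ : c.ι n => disk.{u} n) i
  hm _ := rfl
  g₁ := sigmaDesc c.attachHom
  g₂ := sigmaDesc (c.cellHom n.lt_succ_self)
  isPushout := by
    choose ψ h₁ h₂ using fun (t : PushoutCocone (sigmaDesc c.attachHom)
        (sigmaDesc fun i => basicCell n () ≫ sigmaInj (fun _ : c.ι n => disk.{u} n) i)) =>
      c.exists_sk_desc t.inl (fun i => sigmaInj (fun _ : c.ι n => disk.{u} n) i ≫ t.inr) fun i =>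
        congrArg (sigmaInj (fun _ : c.ι n => ofTop.{u}.obj (TopCat.diskBoundary n)) i ≫ ·) t.condition
    refine ⟨⟨rfl⟩, ⟨PushoutCocone.IsColimit.mk _ ψ h₁ (fun t => ?_) fun t m h h' => ?_⟩⟩
    · exact hom_ext_toFun fun ⟨i, d⟩ => congrFun (congrArg Hom.toFun (h₂ t i)) d
    · exact c.sk_hom_ext (h.trans (h₁ t).symm) fun i =>
        (congrArg (sigmaInj _ i ≫ ·) h').trans (h₂ t i).symm

/-- The inclusions of the subspaces `skObj n` as a cocone. -/
def skCocone : c.skFunctor ⟶ (Functor.const ℕ).obj X where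
  app := c.skIncl
  naturality _ _ _ := rfl

theorem isEmpty_skObj_zero (x : c.skObj 0) : False := by
  obtain ⟨_, m, hm, -⟩ := x
  exact Nat.not_lt_zero m hm

theorem exists_desc (t : Cocone c.skFunctor) :
    ∃ ψ : X ⟶ t.pt, ∀ n, c.skIncl n ≫ ψ = t.ι.app n := by
  choose N hN using c.exists_mem_sk
  -- The chosen stage `N x` is immaterial: any two stages are compared in the larger one.
  let φ (x : X) : t.pt := Hom.toFun (t.ι.app (N x)) ⟨x, hN x⟩
  have hφ (n : ℕ) (x : c.skObj n) : φ x.1 = Hom.toFun (t.ι.app n) x := by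
    have key {k l : ℕ} (h : k ≤ l) (y : c.skObj k) :
        Hom.toFun (t.ι.app l) (Hom.toFun (c.skMap h) y) = Hom.toFun (t.ι.app k) y :=
      congrFun (congrArg Hom.toFun (t.w (homOfLE h))) y
    exact (key (le_max_left (N x.1) n) ⟨x.1, hN x.1⟩).symm.trans (key (le_max_right _ _) x)
  refine ⟨⟨φ, isContinuous_iff_ultrafilter.2 fun U x hU => ?_⟩, fun n => hom_ext_toFun (hφ n)⟩
  obtain ⟨n, i, V, d, hV, rfl, rfl⟩ := (c.converges_iff U x).1 hU
  have e : φ ∘ c.Φ n i = Hom.toFun (c.cellHom n.lt_succ_self i ≫ t.ι.app (n + 1)) :=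
    funext fun d => hφ (n + 1) (Hom.toFun (c.cellHom n.lt_succ_self i) d)
  have := (c.cellHom n.lt_succ_self i ≫ t.ι.app (n + 1)).continuous hV
  rw [← e] at this
  exact this

/-- `X` is the colimit of the subspaces `skObj n`. -/
noncomputable def isColimitSkCocone : IsColimit (Cocone.mk X c.skCocone) where
  desc t := (c.exists_desc t).choose
  fac t := (c.exists_desc t).choose_spec
  uniq t m h := hom_ext_toFun fun x => by
    obtain ⟨n, hn⟩ := c.exists_mem_sk x
    exact congrFun (congrArg Hom.toFun ((h n).trans ((c.exists_desc t).choose_spec n).symm)) ⟨x, hn⟩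

/-- The empty subspace is initial. -/
def isInitialSkZero : IsInitial (c.skObj 0) :=
  IsInitial.ofUniqueHom (fun _ => ⟨fun x => (c.isEmpty_skObj_zero x).elim,
      fun _ x _ => (c.isEmpty_skObj_zero x).elim⟩)
    (fun _ _ => hom_ext_toFun fun x => (c.isEmpty_skObj_zero x).elim)

/-- The CW structure given by a cell decomposition. -/
noncomputable def cwStructure : CWStructure X where
  F := c.skFunctor
  isoBot := c.isInitialSkZero.uniqueUpToIso initialIsInitial
  incl := c.skCocone
  isColimit := c.isColimitSkCocone
  fac := initialIsInitial.hom_ext _ _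
  attachCells n _ := c.attachCells n
  -- Both stages carry the structure induced from `X`, so convergence is literally the same
  -- condition.
  isEmbedding n :=
    { injective := Set.inclusion_injective (c.sk_mono n.le_succ)
      converges_iff := fun _ _ => Iff.rfl }

end CellDecomposition

end PsTop

theorem mainTheorem5 (X Y : PsTop.{u}) (hX : X.IsCWComplex) (hY : Y.IsCWComplex) :
    (X ⨯ Y).IsCWComplex := by
  obtain ⟨c⟩ := hX
  obtain ⟨c'⟩ := hY
  have e : X.prod Y ≅ X ⨯ Y :=
    (PsTop.isLimitProdFan X Y).conePointUniqueUpToIso (limit.isLimit _)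
  exact ⟨((c.cellDecomposition.prod c'.cellDecomposition).ofIso e).cwStructure⟩
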